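/- Let $\tau=\{\sim\}$ be the vocabulary with one binary relation symbol, so that the finite $\tau$-structures are the finite digraphs. A finite digraph is called a basic graph if its edge relation is symmetric and has no self-loops. For a formula $\varphi(X)$ over $\tau$ with equality and with a free set variable $X$, a finite digraph $G$ with vertex set $V$ and $k\in\mathbb N$, write $(G,k)\models\exists^{\le}X\,\varphi(X)$ if there is a set $C\subseteq V$ with $|C|\le k$ and $G\models\varphi(C)$. Let $\mathrm{p\text{-}FD}_{\mathrm{basic}}(E_1^{\le}aa)$ be the class of all parameterized problems of the form $$Q=\{(G,k) : G \text{ is a basic graph and } (G,k)\models \exists^{\le}X\,\forall x\,\forall y\;\psi(X,x,y)\},$$ where $\psi$ is quantifier-free. Let $\mathrm{para\text{-}AC}^0$ be the class of all parameterized problems $Q$ (sets of pairs of a finite digraph $G$ and a parameter $k\in\mathbb N$) for which there is a family $(C_{N,k})_{N,k\in\mathbb N}$ of Boolean circuits with unbounded fan-in, where $C_{N,k}$ has $N$ input bits, such that the depth of all the circuits is bounded by a constant, the size of $C_{N,k}$ is at most $f(k)\cdot (N+1)^{c}$ for some constant $c$ and some computable function $f$, and for every finite digraph $G$ and every $k$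 we have $(G,k)\in Q$ if and only if $C_{N,k}$ outputs $1$ on the encoding of $G$. Here $G$ is encoded by its adjacency matrix, written as a word of length $N=|V|^2$, with respect to an arbitrary enumeration of $V$; the equivalence is required for every enumeration. Then $$\mathrm{p\text{-}FD}_{\mathrm{basic}}(E_1^{\le}aa)\subseteq\mathrm{para\text{-}AC}^0 .$$ -/

import Mathlib

open scoped FirstOrder

namespace WeightedESO

/-! ### Finite structures and parameterized problems -/

/-- A finite `τ`-structure. -/
structure FinStruc (τ : FirstOrder.Language.{0, 0}) where
  carrier : Type
  [finite : Finite carrier]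
  [str : τ.Structure carrier]

attribute [instance] FinStruc.finite FinStruc.str

/-- A set of pairs (finite structure, parameter). -/
abbrev ParamProblem (τ : FirstOrder.Language.{0, 0}) := Set (FinStruc τ × ℕ)

/-! ### Formulas with one free monadic second-order variable -/

/-- The only symbol of `setVar`: a unary relation symbol `X`. -/
inductive SetVarRel : ℕ → Type
  | X : SetVarRel 1

/-- The vocabulary consisting of one unary relation symbol `X`, which plays the role of a monadic
second-order variable. -/
def setVar : FirstOrder.Language.{0, 0} := ⟨fun _ => Empty, SetVarRel⟩

/-- Interpretation of the second-order variable `X` by the set `C`. -/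
@[reducible]
def setVarStructure {U : Type} (C : Finset U) : setVar.Structure U where
  funMap := fun f => f.elim
  RelMap := fun r => match r with
    | SetVarRel.X => fun v => v 0 ∈ C

/-- A formula `φ(X)` over the vocabulary `τ`, with a free monadic second-order variable `X` and
without free first-order variables. -/
abbrev SetSentence (τ : FirstOrder.Language.{0, 0}) := (τ.sum setVar).Sentence

/-- `S ⊨ φ(C)`. -/
def Holds {τ : FirstOrder.Language.{0, 0}} (S : FinStruc τ) (φ : SetSentence τ) (C : Finset S.carrier) :
    Prop :=
  letI := setVarStructure C
  S.carrier ⊨ φ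

/-- `(S, k) ⊨ ∃^≤ X φ(X)`. -/
def ModelsLe {τ : FirstOrder.Language.{0, 0}} (S : FinStruc τ) (k : ℕ) (φ : SetSentence τ) : Prop :=
  ∃ C : Finset S.carrier, C.card ≤ k ∧ Holds S φ C

/-! ### Quantifier patterns -/

/-- First-order quantifiers: `e` is existential, `a` is universal. -/
inductive FOQuantifier
  | e
  | a

/-- `HasPattern p φ`: the formula `φ` consists of first-order quantifiers following the pattern `p`,
followed by a quantifier-free formula. -/
inductive HasPattern {L : FirstOrder.Language.{0, 0}} :
    {n : ℕ} → List FOQuantifier → L.BoundedFormula Empty n → Prop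
  | qf {n : ℕ} {φ : L.BoundedFormula Empty n} : φ.IsQF → HasPattern [] φ
  | ex {n : ℕ} {p : List FOQuantifier} {φ : L.BoundedFormula Empty (n + 1)} :
      HasPattern p φ → HasPattern (FOQuantifier.e :: p) φ.ex
  | all {n : ℕ} {p : List FOQuantifier} {φ : L.BoundedFormula Empty (n + 1)} :
      HasPattern p φ → HasPattern (FOQuantifier.a :: p) φ.all

/-! ### Problems on basic graphs -/

/-- The digraph `S` is a basic graph: no self-loops, and a symmetric edge relation. -/
def IsBasic (S : FinStruc FirstOrder.Language.graph) : Prop :=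
  S.carrier ⊨ FirstOrder.Language.Theory.simpleGraph

/-- The parameterized problem described on basic graphs by `∃^≤ X φ(X)`. -/
def pModelsBasicLe (φ : SetSentence FirstOrder.Language.graph) : ParamProblem FirstOrder.Language.graph :=
  {q | IsBasic q.1 ∧ ModelsLe q.1 q.2 φ}

/-- The class p-FD_basic(E₁^≤ p). -/
def PFDBasicLe (p : List FOQuantifier) : Set (ParamProblem FirstOrder.Language.graph) :=
  {Q | ∃ φ : SetSentence FirstOrder.Language.graph, HasPattern p φ ∧ Q = pModelsBasicLe φ}

/-! ### Circuits of unbounded fan-in -/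

/-- The gate types of a circuit with `N` input bits and with gates named by `V`. Conjunctions and
disjunctions have unbounded fan-in (the empty ones are the constants). -/
inductive Gate (N : ℕ) (V : Type)
  | input (i : Fin N)
  | neg (w : V)
  | conj (s : Finset V)
  | disj (s : Finset V)

/-- The gates whose values a gate reads. -/
def Gate.preds {N : ℕ} {V : Type} : Gate N V → Finset V
  | .input _ => ∅
  | .neg w => {w}
  | .conj s => s
  | .disj s => s

/-- The value of a gate on the input `x`, given the values `val` of the gates that it reads. -/
def Gate.Value {N : ℕ} {V : Type} (x : Fin N → Bool) (val : V → Prop) : Gate N V → Prop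
  | .input i => x i = true
  | .neg w => ¬ val w
  | .conj s => ∀ w ∈ s, val w
  | .disj s => ∃ w ∈ s, val w

/-- A Boolean circuit with `N` input bits: a finite directed acyclic graph of gates with a
distinguished output gate. -/
structure Circuit (N : ℕ) where
  V : Type
  [fintype : Fintype V]
  gate : V → Gate N V
  acyclic : WellFounded fun w v => w ∈ (gate v).preds
  output : V

attribute [instance] Circuit.fintype

namespace Circuit

variable {N : ℕ} (C : Circuit N)

/-- The number of gates. -/
def size : ℕ := Fintype.card C.V

/-- The length of a longest path of wires that ends in the gate `v`. -/
noncomputable def gateDepth : C.V → ℕ :=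
  C.acyclic.fix fun v rec =>
    (C.gate v).preds.attach.sup fun w => rec w.1 w.2 + 1

/-- The depth of a circuit: the length of a longest path of wires. -/
noncomputable def depth : ℕ := Finset.univ.sup C.gateDepth

/-- The gate `v` has value 1 on the input `x`. See `gateTrue_iff` for the recursion. -/
def GateTrue (x : Fin N → Bool) : C.V → Prop :=
  C.acyclic.fix fun v rec =>
    (C.gate v).Value x fun w => ∃ h : w ∈ (C.gate v).preds, rec w h

theorem gateTrue_iff (x : Fin N → Bool) (v : C.V) :
    C.GateTrue x v ↔ (C.gate v).Value x (C.GateTrue x) := by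
  rw [GateTrue, WellFounded.fix_eq]
  cases C.gate v <;> simp +contextual [Gate.Value, Gate.preds]

theorem gateDepth_eq (v : C.V) :
    C.gateDepth v = (C.gate v).preds.sup fun w => C.gateDepth w + 1 := by
  rw [gateDepth, WellFounded.fix_eq]
  exact Finset.sup_attach _ (fun w => C.gateDepth w + 1)

/-- The circuit outputs 1 on the input `x`. -/
def Accepts (x : Fin N → Bool) : Prop := C.GateTrue x C.output

end Circuit

/-! ### The class para-AC⁰ -/

open Classical in
/-- The encoding of a digraph with `n` vertices, enumerated by `e`, as a word of length `n * n`: its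
adjacency matrix, row by row. -/
noncomputable def adjMatrixWord {S : FinStruc FirstOrder.Language.graph} {n : ℕ} (e : S.carrier ≃ Fin n) :
    Fin (n * n) → Bool :=
  fun i => decide (FirstOrder.Language.Structure.RelMap FirstOrder.Language.adj
    ![e.symm (finProdFinEquiv.symm i).1, e.symm (finProdFinEquiv.symm i).2])

/-- The class para-AC⁰ of parameterized problems on digraphs: there is a family of circuits `C N k`
of unbounded fan-in, of constant depth and of size `f k * N ^ O(1)` for some computable `f`, such
that `C N k` decides the instances with encoding length `N` and parameter `k`, whatever
enumeration of the vertices the encoding uses. The bound is written with `N + 1` so that it is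
meaningful for the encoding of the empty graph, which has length `0`; for `N ≥ 1` this changes
only `f`. -/
def ParaAC0 : Set (ParamProblem FirstOrder.Language.graph) :=
  {Q | ∃ (C : (N k : ℕ) → Circuit N) (d c : ℕ) (f : ℕ → ℕ), Computable f ∧
    (∀ N k, (C N k).depth ≤ d ∧ (C N k).size ≤ f k * (N + 1) ^ c) ∧
    ∀ (S : FinStruc FirstOrder.Language.graph) (k n : ℕ) (e : S.carrier ≃ Fin n),
      (S, k) ∈ Q ↔ (C (n * n) k).Accepts (adjMatrixWord e)}

end WeightedESO

/-! On basic graphs `ψ` depends only on whether each of its two vertices lies in `X`, whether they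
are adjacent and whether they are equal, so it is a constraint `R` on pairs (`exists_truthTable`).
Suppose some `C` with at most `k` vertices is a solution and `∅` is not. Then the complement of `C`
is a clique or an independent set: an edge and a non-edge outside `C`, together with a diagonal
pair, would show that `∅` satisfies `R`. So vertices outside `C` with the same neighbours in `C` are
twins, which leaves at most `2 ^ k` types outside `C`.

Exchanging twins is an automorphism. Fix a colouring with boundedly many colours that is injective
on a solution of least index sum, and keep only the least vertex of each colour among its twins. The
solution survives in this kernel (`exists_subset_kernel`), whose size is bounded in `k`
(`card_kernel_le`).

There are too many `k`-subsets to try them all. Instead, hash families of size `f(k) * (n + 1)`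
(`exists_hash_family`) supply the colouring and a second function that is injective on the kernel,
so that a set of colours describes `C`. By `exists_satisfies_iff` a fixed number of quantifiers over
ranges of this size suffices, and the closure properties of `AC` turn them into circuits. -/

namespace WeightedESO

/-! ### Predicates computed by circuits of bounded depth -/

/-- Renaming of the gates that a gate reads. -/
def Gate.map {N : ℕ} {V W : Type} (f : V ↪ W) : Gate N V → Gate N W
  | .input i => .input i
  | .neg w => .neg (f w)
  | .conj s => .conj (s.map f)
  | .disj s => .disj (s.map f)

theorem Gate.preds_map {N : ℕ} {V W : Type} (f : V ↪ W) (g : Gate N V) :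
    (g.map f).preds = g.preds.map f := by
  cases g <;> simp [Gate.map, Gate.preds]

theorem Gate.value_map {N : ℕ} {V W : Type} (f : V ↪ W) (g : Gate N V) (x : Fin N → Bool)
    (val : W → Prop) : (g.map f).Value x val ↔ g.Value x (val ∘ f) := by
  cases g <;> simp [Gate.map, Gate.Value]

/-- The predicate `P` of words of length `N` is computed by a circuit of depth at most `t` and of
size at most `(q + 1) ^ t`. The acyclicity of the circuit is witnessed by a rank function. -/
def AC {N : ℕ} (q t : ℕ) (P : (Fin N → Bool) → Prop) : Prop :=
  ∃ (V : Type) (_ : Fintype V) (gate : V → Gate N V) (rank : V → ℕ) (out : V),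
    (∀ v, ∀ w ∈ (gate v).preds, rank w < rank v) ∧ (∀ v, rank v ≤ t) ∧
    Fintype.card V ≤ (q + 1) ^ t ∧
    ∀ x, ∃ val : V → Prop, (∀ v, val v ↔ (gate v).Value x val) ∧ (val out ↔ P x)

namespace AC

variable {N q t s : ℕ} {P Q : (Fin N → Bool) → Prop}

theorem congr (h : AC q t P) (e : ∀ x, P x ↔ Q x) : AC q t Q := by
  have : P = Q := funext fun x => propext (e x)
  exact this ▸ h

theorem mono (h : AC q t P) (hts : t ≤ s) : AC q s P := by
  obtain ⟨V, i, gate, rank, out, h1, h2, h3, h4⟩ := h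
  exact ⟨V, i, gate, rank, out, h1, fun v => (h2 v).trans hts,
    h3.trans (Nat.pow_le_pow_right (Nat.succ_pos q) hts), h4⟩

theorem bit (i : Fin N) : AC q 0 fun x => x i = true :=
  ⟨Unit, inferInstance, fun _ => .input i, fun _ => 0, (), by simp [Gate.preds], by simp, by simp,
    fun x => ⟨fun _ => x i = true, by simp [Gate.Value], Iff.rfl⟩⟩

theorem not (h : AC q t P) (hq : 1 ≤ q) : AC q (t + 1) fun x => ¬ P x := by
  obtain ⟨V, i, gate, rank, out, h1, h2, h3, h4⟩ := h
  refine ⟨Option V, inferInstance,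
    fun v => v.elim (.neg (some out)) fun v => (gate v).map Function.Embedding.some,
    fun v => v.elim (t + 1) rank, none, ?_, ?_, ?_, fun x => ?_⟩
  · rintro (_ | v) w hw
    · simp only [Option.elim, Gate.preds, Finset.mem_singleton] at hw
      subst hw
      exact Nat.lt_succ_of_le (h2 out)
    · simp only [Option.elim, Gate.preds_map, Finset.mem_map] at hw
      obtain ⟨w, hw, rfl⟩ := hw
      exact h1 v w hw
  · rintro (_ | v)
    · exact le_rfl
    · exact (h2 v).trans t.le_succ
  · rw [Fintype.card_option, pow_succ]
    have : 1 ≤ (q + 1) ^ t := Nat.one_le_pow _ _ q.succ_pos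
    nlinarith
  · obtain ⟨val, hv, ho⟩ := h4 x
    refine ⟨fun v => v.elim (¬ P x) val, ?_, Iff.rfl⟩
    rintro (_ | v)
    · simp [Gate.Value, ho]
    · exact (hv v).trans (Gate.value_map Function.Embedding.some (gate v) x
        fun v => v.elim (¬ P x) val).symm

theorem all {ι : Type} [Fintype ι] {P : ι → (Fin N → Bool) → Prop} (h : ∀ i, AC q t (P i))
    (hι : Fintype.card ι ≤ q) : AC q (t + 1) fun x => ∀ i, P i x := by
  choose V inst gate rank out h1 h2 h3 h4 using h
  let f (i : ι) : V i ↪ Option (Σ i, V i) :=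
    (Function.Embedding.sigmaMk i).trans Function.Embedding.some
  let o : ι ↪ Option (Σ i, V i) :=
    ⟨fun i => some ⟨i, out i⟩, fun i j hij => by simpa using congrArg (Option.map Sigma.fst) hij⟩
  refine ⟨Option (Σ i, V i), inferInstance,
    fun v => v.elim (.conj (Finset.univ.map o)) fun v => (gate v.1 v.2).map (f v.1),
    fun v => v.elim (t + 1) fun v => rank v.1 v.2, none, ?_, ?_, ?_, fun x => ?_⟩
  · rintro (_ | ⟨i, v⟩) w hw
    · simp only [Option.elim, Gate.preds, Finset.mem_map] at hw
      obtain ⟨i, -, rfl⟩ := hw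
      exact Nat.lt_succ_of_le (h2 i (out i))
    · simp only [Option.elim, Gate.preds_map, Finset.mem_map] at hw
      obtain ⟨w, hw, rfl⟩ := hw
      exact h1 i v w hw
  · rintro (_ | ⟨i, v⟩)
    · exact le_rfl
    · exact (h2 i v).trans t.le_succ
  -- At most `q` circuits of size `(q + 1) ^ t` fill `q * (q + 1) ^ t` gates; the new gate fits in
  -- the remaining `(q + 1) ^ t`.
  · rw [Fintype.card_option, Fintype.card_sigma, pow_succ]
    have h5 : ∑ i, Fintype.card (V i) ≤ Fintype.card ι * (q + 1) ^ t := by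
      simpa using Finset.sum_le_card_nsmul Finset.univ _ _ fun i _ => h3 i
    have : 1 ≤ (q + 1) ^ t := Nat.one_le_pow _ _ q.succ_pos
    nlinarith [Nat.mul_le_mul_right ((q + 1) ^ t) hι]
  · choose val hv ho using fun i => h4 i x
    refine ⟨fun v => v.elim (∀ i, P i x) fun v => val v.1 v.2, ?_, Iff.rfl⟩
    rintro (_ | ⟨i, v⟩)
    · simp only [Option.elim, Gate.Value, Finset.mem_map, Finset.mem_univ, true_and,
        forall_exists_index, forall_apply_eq_imp_iff]
      exact forall_congr' fun i => (ho i).symm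
    · exact (hv i v).trans (Gate.value_map (f i) (gate i v) x
        fun v => v.elim (∀ i, P i x) fun v => val v.1 v.2).symm

theorem ex {ι : Type} [Fintype ι] {P : ι → (Fin N → Bool) → Prop} (h : ∀ i, AC q t (P i))
    (hι : Fintype.card ι ≤ q) (hq : 1 ≤ q) : AC q (t + 3) fun x => ∃ i, P i x :=
  ((all (fun i => (h i).not hq) hι).not hq).congr fun x => by simp

theorem const (p : Prop) (hq : 1 ≤ q) : AC q 2 fun _ : Fin N → Bool => p := by
  have h : AC q 1 fun _ : Fin N → Bool => True :=
    (all (ι := Empty) (t := 0) (P := fun _ _ => True) nofun (by simp)).congr (by simp)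
  by_cases hp : p
  · exact (h.mono one_le_two).congr (by simp [hp])
  · exact (h.not hq).congr (by simp [hp])

theorem and (hP : AC q t P) (hQ : AC q s Q) (hq : 2 ≤ q) :
    AC q (max t s + 1) fun x => P x ∧ Q x :=
  (all (ι := Bool) (P := fun b => if b then P else Q)
    (by rintro (_ | _)
        · exact hQ.mono (le_max_right _ _)
        · exact hP.mono (le_max_left _ _)) (by simpa using hq)).congr
    fun x => by simp [Bool.forall_bool, and_comm]

theorem imp (hP : AC q t P) (hQ : AC q s Q) (hq : 2 ≤ q) :
    AC q (max t (s + 1) + 2) fun x => P x → Q x :=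
  ((hP.and (hQ.not (by omega)) hq).not (by omega)).congr fun x => by tauto

/-- Case distinction on the truth value of `P x`. It lets an arbitrary Boolean function, such as the
constraint `R`, be evaluated one argument at a time. -/
theorem apply_imp (hP : AC q t P) (hq : 2 ≤ q) {F : Prop → (Fin N → Bool) → Prop}
    (hF : ∀ p, AC q s (F p)) : AC q (max t s + 5) fun x => F (P x) x := by
  have h1 := hP.imp (hF True) hq
  have h2 := (hP.not (by omega)).imp (hF False) hq
  refine ((h1.and h2 hq).congr fun x => ?_).mono (by omega)
  by_cases h : P x <;> simp [h]

/-- The rank dominates the gate depth, and by induction along the wires a consistent valuation is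
unique. -/
theorem exists_circuit (h : AC q t P) :
    ∃ C : Circuit N, C.depth ≤ t ∧ C.size ≤ (q + 1) ^ t ∧ ∀ x, C.Accepts x ↔ P x := by
  obtain ⟨V, i, gate, rank, out, h1, h2, h3, h4⟩ := h
  have wf : WellFounded fun w v => w ∈ (gate v).preds :=
    Subrelation.wf (fun {w v} h => h1 v w h) (InvImage.wf rank Nat.lt_wfRel.wf)
  let C : Circuit N := ⟨V, gate, wf, out⟩
  have hd (v : V) : C.gateDepth v ≤ rank v := by
    induction v using wf.induction with
    | _ v ih =>
      rw [C.gateDepth_eq]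
      exact Finset.sup_le fun w hw => Nat.succ_le_of_lt ((ih w hw).trans_lt (h1 v w hw))
  refine ⟨C, Finset.sup_le fun v _ => (hd v).trans (h2 v), h3, fun x => ?_⟩
  obtain ⟨val, hv, ho⟩ := h4 x
  rw [← ho]
  have key (v : V) : C.GateTrue x v ↔ val v := by
    induction v using wf.induction with
    | _ v ih =>
      rw [C.gateTrue_iff, hv]
      change (gate v).Value x _ ↔ _
      generalize gate v = g at ih
      cases g with
      | input i => rfl
      | neg w => exact not_congr (ih w (by simp [Gate.preds]))
      | conj s => exact forall₂_congr ih
      | disj s => exact exists_congr fun w => and_congr_right fun hw => ih w hw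
  exact key out

end AC

/-! ### Perfect hash families -/

theorem card_filter_dvd_range_le (m p : ℕ) (hm : 0 < m) :
    ((Finset.range p).filter (m ∣ ·)).card ≤ p / m + 1 := by
  calc _ ≤ ((Finset.range (p / m + 1)).image (m * ·)).card := by
        refine Finset.card_le_card fun x hx => ?_
        simp only [Finset.mem_filter, Finset.mem_range] at hx
        obtain ⟨hx, c, rfl⟩ := hx
        refine Finset.mem_image.2 ⟨c, Finset.mem_range.2 (Nat.lt_succ_of_le ?_), rfl⟩
        rw [Nat.le_div_iff_mul_le hm]
        nlinarith
    _ ≤ p / m + 1 := by simpa using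
        Finset.card_image_le (s := Finset.range (p / m + 1)) (f := (m * ·))

/-- Few multipliers `a` make two distinct residues `x`, `y` collide under `x ↦ a * x mod p mod m`. -/
theorem card_collisions_le (p m : ℕ) [Fact p.Prime] (hm : 0 < m) {x y : ZMod p} (hxy : x ≠ y) :
    (Finset.univ.filter fun a : ZMod p => (a * x).val % m = (a * y).val % m).card ≤
      2 * (p / m + 1) := by
  classical
  have hd (d : ZMod p) (hd : d ≠ 0) :
      (Finset.univ.filter fun a : ZMod p => m ∣ (a * d).val).card ≤ p / m + 1 := by
    refine le_trans ?_ (card_filter_dvd_range_le m p hm)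
    refine Finset.card_le_card_of_injOn (fun a => (a * d).val) (fun a ha => ?_) ?_
    · simpa [ZMod.val_lt] using ha
    · intro a _ b _ hab
      exact mul_right_cancel₀ hd (ZMod.val_injective p hab)
  have key (u v : ZMod p) (h : u.val % m = v.val % m) (hvu : v.val ≤ u.val) : m ∣ (u - v).val := by
    rw [ZMod.val_sub hvu]
    exact (Nat.modEq_iff_dvd' hvu).1 h.symm
  calc _ ≤ ((Finset.univ.filter fun a : ZMod p => m ∣ (a * (x - y)).val) ∪
        (Finset.univ.filter fun a : ZMod p => m ∣ (a * (y - x)).val)).card := by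
        refine Finset.card_le_card fun a ha => ?_
        simp only [Finset.mem_filter, Finset.mem_univ, true_and, Finset.mem_union, mul_sub] at ha ⊢
        -- Subtracting the smaller residue from the larger one does not wrap around modulo `p`, so
        -- congruence modulo `m` passes to the residue of the difference.
        rcases le_total (a * y).val (a * x).val with h | h
        · exact .inl (key _ _ ha h)
        · exact .inr (key _ _ ha.symm h)
    _ ≤ _ := Finset.card_union_le _ _
    _ ≤ _ := by
        have h1 := hd (x - y) (sub_ne_zero.2 hxy)
        have h2 := hd (y - x) (sub_ne_zero.2 hxy.symm)
        omega

/-- Multiplicative hashing `x ↦ a * x mod p mod m`, with a union bound over the at most `s ^ 2`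
ordered pairs from `T`. -/
theorem exists_hash_family (s n : ℕ) :
    ∃ (M : ℕ) (h : Fin M → Fin n → Fin (4 * s ^ 2 + 1)), M ≤ (8 * s ^ 2 + 4) * (n + 1) ∧
      ∀ T : Finset (Fin n), T.card ≤ s → ∃ a, Set.InjOn (h a) T := by
  classical
  -- `p > n` keeps the vertices distinct modulo `p`, `p > 4 * s ^ 2` absorbs the rounding term of
  -- the collision bound, and Bertrand's postulate keeps the family linear in `n`.
  obtain ⟨p, hp, hlt, hle⟩ := Nat.exists_prime_lt_and_le_two_mul (n + 4 * s ^ 2 + 1) (by omega)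
  have := Fact.mk hp
  set m := 4 * s ^ 2 + 1 with hm
  have hm0 : 0 < m := by omega
  have hcard : Fintype.card (ZMod p) = p := ZMod.card p
  let e : Fin p ≃ ZMod p := (Fintype.equivFinOfCardEq hcard).symm
  refine ⟨p, fun a x => ⟨(e a * (x.val : ZMod p)).val % m, Nat.mod_lt _ hm0⟩, by nlinarith,
    fun T hT => ?_⟩
  let bad (z : Fin n × Fin n) : Finset (ZMod p) := Finset.univ.filter fun a =>
    (a * (z.1.val : ZMod p)).val % m = (a * (z.2.val : ZMod p)).val % m
  have hbad : (T.offDiag.biUnion bad).card < Fintype.card (ZMod p) := by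
    have h1 : (T.offDiag.biUnion bad).card ≤ T.offDiag.card * (2 * (p / m + 1)) := by
      refine Finset.card_biUnion_le_card_mul _ _ _ fun z hz => ?_
      refine card_collisions_le p m hm0 fun h => (Finset.mem_offDiag.1 hz).2.2 (Fin.ext ?_)
      have h2 := congrArg ZMod.val h
      rwa [ZMod.val_cast_of_lt (by omega), ZMod.val_cast_of_lt (by omega)] at h2
    have h2 : T.offDiag.card ≤ s ^ 2 := by
      rw [Finset.offDiag_card]
      nlinarith [Nat.sub_le (T.card * T.card) T.card]
    have h3 : p / m * m ≤ p := Nat.div_mul_le_self p m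
    rw [hcard]
    generalize p / m = c at *
    have h4 := h1.trans (Nat.mul_le_mul_right (2 * (c + 1)) h2)
    rw [hm] at h3
    -- Both `2 * s ^ 2 * c` and `2 * s ^ 2` are at most `p / 2`, the second strictly.
    nlinarith
  obtain ⟨a, ha⟩ : ∃ a, a ∉ T.offDiag.biUnion bad := by
    by_contra! h
    rw [Finset.eq_univ_iff_forall.2 h, Finset.card_univ] at hbad
    exact lt_irrefl _ hbad
  refine ⟨e.symm a, fun x hx y hy hxy => ?_⟩
  by_contra hne
  refine ha (Finset.mem_biUnion.2 ⟨(x, y), Finset.mem_offDiag.2 ⟨hx, hy, hne⟩, ?_⟩)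
  simpa [bad] using hxy

/-! ### Solutions inside a kernel of twin representatives -/

section Kernel

variable {n : ℕ}

/-- Every pair of vertices satisfies the constraint `R`, which depends on the membership of the
two vertices in `D`, on their adjacency and on their equality. -/
def Satisfies (R : Prop → Prop → Prop → Prop → Prop) (A : Fin n → Fin n → Prop)
    (D : Fin n → Prop) : Prop :=
  ∀ u v, R (D u) (D v) (A u v) (u = v)

/-- The vertices `v` and `w` have the same neighbours, apart from `v` and `w` themselves. -/
def Twin (A : Fin n → Fin n → Prop) (v w : Fin n) : Prop :=
  ∀ z, z ≠ v → z ≠ w → (A v z ↔ A w z)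

/-- The vertices that are least among their twins of the same colour. -/
def Kernel {m : ℕ} (A : Fin n → Fin n → Prop) (c : Fin n → Fin m) (v : Fin n) : Prop :=
  ∀ w, w < v → c w = c v → ¬ Twin A v w

variable {R : Prop → Prop → Prop → Prop → Prop} {A : Fin n → Fin n → Prop}

/-- The transposition of two twins is an automorphism: other vertices do not distinguish them, and
symmetry and irreflexivity settle the pairs inside `{v, w}`. -/
theorem Twin.swap_iff (hs : ∀ u v, A u v → A v u) (hi : ∀ u, ¬ A u u) {v w : Fin n}
    (h : Twin A v w) (a b : Fin n) :
    A (Equiv.swap v w a) (Equiv.swap v w b) ↔ A a b := by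
  have hc (u v) : A u v ↔ A v u := ⟨hs u v, hs v u⟩
  simp only [Equiv.swap_apply_def]
  split_ifs with h1 h2 h3 h4 h5 h6 h7 h8 <;> subst_vars <;> try simp [hi]
  all_goals first
    | exact hc _ _
    | exact (h _ ‹_› ‹_›).symm
    | exact h _ ‹_› ‹_›
    | exact (hc _ _).trans ((h _ ‹_› ‹_›).symm.trans (hc _ _))
    | exact (hc _ _).trans ((h _ ‹_› ‹_›).trans (hc _ _))

/-- Exchanging a member of a solution for a twin outside gives a solution. -/
theorem Satisfies.exchange (hs : ∀ u v, A u v → A v u) (hi : ∀ u, ¬ A u u) {C : Finset (Fin n)}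
    (hC : Satisfies R A (· ∈ C)) {v w : Fin n} (h : Twin A v w) :
    Satisfies R A (· ∈ C.map (Equiv.swap v w).toEmbedding) := by
  intro a b
  have := hC (Equiv.swap v w a) (Equiv.swap v w b)
  rw [h.swap_iff hs hi, (Equiv.swap v w).injective.eq_iff] at this
  simpa [Finset.mem_map_equiv] using this

/-- If there is a solution, then a solution is contained in the kernel of every colouring from a
family that separates the small sets. -/
theorem exists_subset_kernel {M m k : ℕ} (c : Fin M → Fin n → Fin m)
    (hc : ∀ T : Finset (Fin n), T.card ≤ k → ∃ a, Set.InjOn (c a) T)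
    (hs : ∀ u v, A u v → A v u) (hi : ∀ u, ¬ A u u)
    (h : ∃ C : Finset (Fin n), C.card ≤ k ∧ Satisfies R A (· ∈ C)) :
    ∃ (C : Finset (Fin n)) (a : Fin M), C.card ≤ k ∧ Satisfies R A (· ∈ C) ∧
      ∀ v ∈ C, Kernel A (c a) v := by
  classical
  let sols := Finset.univ.filter fun C : Finset (Fin n) => C.card ≤ k ∧ Satisfies R A (· ∈ C)
  have hne : sols.Nonempty := by
    obtain ⟨C, hC⟩ := h
    exact ⟨C, by simpa [sols] using hC⟩
  obtain ⟨C, hC, hmin⟩ := Finset.exists_min_image sols (fun C => ∑ v ∈ C, v.val) hne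
  obtain ⟨hk, hC⟩ : C.card ≤ k ∧ Satisfies R A (· ∈ C) := by simpa [sols] using hC
  obtain ⟨a, ha⟩ := hc C hk
  refine ⟨C, a, hk, hC, fun v hv w hwv hcol ht => ?_⟩
  -- Since the colouring is injective on `C`, the smaller twin `w` lies outside, and swapping it in
  -- for `v` would lower the index sum.
  have hw : w ∉ C := fun hw => hwv.ne (ha hw hv hcol)
  have h1 := hmin (C.map (Equiv.swap v w).toEmbedding)
    (by simpa [sols, hk] using hC.exchange hs hi ht)
  rw [Finset.sum_map, ← Finset.add_sum_erase _ _ hv, ← Finset.add_sum_erase C _ hv] at h1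
  have h2 : ∑ x ∈ C.erase v, ((Equiv.swap v w).toEmbedding x).val = ∑ x ∈ C.erase v, x.val := by
    refine Finset.sum_congr rfl fun x hx => ?_
    rw [Finset.mem_erase] at hx
    rw [Equiv.coe_toEmbedding, Equiv.swap_apply_of_ne_of_ne hx.1 (fun h => hw (by rw [← h]; exact hx.2))]
  rw [h2] at h1
  simp only [Equiv.coe_toEmbedding, Equiv.swap_apply_left] at h1
  exact absurd hwv (by simpa using h1)

open Classical in
/-- The kernel is small if there is a solution, but the empty set is none: then the
complement of the solution is a clique or an independent set. -/
theorem card_kernel_le {m : ℕ} (c : Fin n → Fin m) (hi : ∀ u, ¬ A u u)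
    {C : Finset (Fin n)} (hC : Satisfies R A (· ∈ C))
    (h0 : ¬ Satisfies R A fun _ => False) :
    (Finset.univ.filter (Kernel A c)).card ≤ C.card + m * 2 ^ C.card := by
  have htwin {v w z : Fin n} (hv : v ∉ C) (hw : w ∉ C) (hz : z ∉ C) (hzv : z ≠ v) (hzw : z ≠ w)
      (h1 : A v z) (h2 : ¬ A w z) : False := by
    refine h0 fun a b => ?_
    have hd := hC v v
    have he := hC v z
    have hn := hC w z
    -- `hd`, `he` and `hn` are `R` on a diagonal pair, an edge and a non-edge without members of
    -- `C`: all the cases that `∅` has to satisfy.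
    simp only [hv, hw, hz, h1, h2, hzv.symm, hzw.symm, hi] at hd he hn
    by_cases hab : a = b
    · subst hab; simpa [hi] using hd
    · by_cases hA : A a b <;> simpa [hab, hA]
  have hinj : ((Finset.univ.filter (Kernel A c)) \ C).card ≤
      ((Finset.univ : Finset (Fin m)) ×ˢ C.powerset).card := by
    refine Finset.card_le_card_of_injOn (fun v => (c v, C.filter (A v))) (fun v _ => Finset.mem_coe.2
      (Finset.mk_mem_product (Finset.mem_univ _) (Finset.mem_powerset.2 (Finset.filter_subset _ _)))) ?_
    intro v hv w hw hvw
    simp only [Finset.coe_sdiff, Finset.coe_filter, Finset.mem_univ, true_and, Set.mem_sdiff,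
      Set.mem_ofPred_eq, Finset.mem_coe, Prod.mk.injEq] at hv hw hvw
    have ht : Twin A v w := by
      intro z hzv hzw
      by_cases hz : z ∈ C
      · have := Finset.ext_iff.1 hvw.2 z
        simpa [hz] using this
      · by_contra hne
        by_cases hA : A v z
        · exact htwin hv.2 hw.2 hz hzv hzw hA (by tauto)
        · exact htwin hw.2 hv.2 hz hzw hzv (by tauto) hA
    -- Of two distinct twins of equal colour, the larger is not in the kernel.
    rcases lt_trichotomy v w with h | h | h
    · exact absurd (fun z h1 h2 => (ht z h2 h1).symm) (hw.1 v h hvw.1)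
    · exact h
    · exact absurd ht (hv.1 w h hvw.1.symm)
  rw [Finset.card_product, Finset.card_powerset, Finset.card_univ, Fintype.card_fin] at hinj
  have := Finset.card_le_card_sdiff_add_card (t := C) (s := Finset.univ.filter (Kernel A c))
  omega

/-- The existence of a small solution, expressed by a bounded number of quantifiers over hash
functions, sets of colours and vertices. -/
theorem exists_satisfies_iff {M₁ M₂ m₁ m₂ k : ℕ} (c₁ : Fin M₁ → Fin n → Fin m₁)
    (c₂ : Fin M₂ → Fin n → Fin m₂)
    (h₁ : ∀ T : Finset (Fin n), T.card ≤ k → ∃ a, Set.InjOn (c₁ a) T)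
    (h₂ : ∀ T : Finset (Fin n), T.card ≤ k + m₁ * 2 ^ k → ∃ a, Set.InjOn (c₂ a) T)
    (hs : ∀ u v, A u v → A v u) (hi : ∀ u, ¬ A u u) :
    (∃ C : Finset (Fin n), C.card ≤ k ∧ Satisfies R A (· ∈ C)) ↔
    ∃ (a : Fin M₁) (b : Fin M₂) (S : {S : Finset (Fin m₂) // S.card ≤ k}),
      (∀ u v, (c₂ b u ∈ S.1 ∧ Kernel A (c₁ a) u) → (c₂ b v ∈ S.1 ∧ Kernel A (c₁ a) v) →
        c₂ b u = c₂ b v → u = v) ∧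
      Satisfies R A fun v => c₂ b v ∈ S.1 ∧ Kernel A (c₁ a) v := by
  classical
  constructor
  · intro h
    by_cases h0 : Satisfies R A fun _ => False
    · obtain ⟨a, -⟩ := h₁ ∅ (by simp)
      obtain ⟨b, -⟩ := h₂ ∅ (by simp)
      exact ⟨a, b, ⟨∅, by simp⟩, by simp, by simpa using h0⟩
    · obtain ⟨C, a, hk, hC, hCK⟩ := exists_subset_kernel c₁ h₁ hs hi h
      obtain ⟨b, hb⟩ := h₂ (Finset.univ.filter (Kernel A (c₁ a)))
        ((card_kernel_le (c₁ a) hi hC h0).trans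
          (add_le_add hk (Nat.mul_le_mul_left _ (Nat.pow_le_pow_right two_pos hk))))
      have hb' {u v} (hu : Kernel A (c₁ a) u) (hv : Kernel A (c₁ a) v) (h : c₂ b u = c₂ b v) :
          u = v := hb (by simpa using hu) (by simpa using hv) h
      refine ⟨a, b, ⟨C.image (c₂ b), Finset.card_image_le.trans hk⟩,
        fun u v hu hv => hb' hu.2 hv.2, ?_⟩
      have : (fun v => c₂ b v ∈ C.image (c₂ b) ∧ Kernel A (c₁ a) v) = (· ∈ C) := by
        ext v
        constructor
        · rintro ⟨hv, hK⟩
          obtain ⟨u, hu, huv⟩ := Finset.mem_image.1 hv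
          exact hb' (hCK u hu) hK huv ▸ hu
        · exact fun hv => ⟨Finset.mem_image_of_mem _ hv, hCK v hv⟩
      exact this ▸ hC
  · rintro ⟨a, b, S, hinj, hS⟩
    -- Whatever was guessed, the described set is itself a solution: `c₂ b` is injective on it and
    -- maps it into `S`, so it has at most `k` elements.
    refine ⟨Finset.univ.filter fun v => c₂ b v ∈ S.1 ∧ Kernel A (c₁ a) v, ?_, by simpa using hS⟩
    refine le_trans (Finset.card_le_card_of_injOn (c₂ b) (t := S.1) (fun v hv => ?_) ?_) S.2
    · simp only [Finset.coe_filter, Set.mem_ofPred_eq] at hv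
      exact hv.2.1
    · intro u hu v hv huv
      simp only [Finset.coe_filter, Set.mem_ofPred_eq] at hu hv
      exact hinj u v hu.2 hv.2 huv

end Kernel

/-! ### Truth tables of quantifier-free formulas -/

open FirstOrder Language

theorem exists_eq_var (t : (Language.graph.sum setVar).Term (Empty ⊕ Fin 2)) :
    ∃ i : Fin 2, t = Term.var (Sum.inr i) := by
  rcases t with (e | i) | ⟨f, -⟩
  · exact e.elim
  · exact ⟨i, rfl⟩
  · rcases f with f | f <;> exact Empty.elim f

/-- On basic graphs, a quantifier-free formula in two variables only depends on the membership of
the two elements in `X`, on their adjacency and on their equality. -/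
theorem exists_truthTable {ψ : (Language.graph.sum setVar).BoundedFormula Empty 2}
    (hψ : ψ.IsQF) : ∃ R : Prop → Prop → Prop → Prop → Prop,
      ∀ (S : FinStruc Language.graph) (C : Finset S.carrier), IsBasic S →
        ∀ (x : Empty → S.carrier) (v : Fin 2 → S.carrier),
          letI := setVarStructure C
          ψ.Realize x v ↔
            R (v 0 ∈ C) (v 1 ∈ C) (Structure.RelMap adj ![v 0, v 1]) (v 0 = v 1) := by
  induction hψ with
  | falsum => exact ⟨fun _ _ _ _ => False, fun _ _ _ _ _ => Iff.rfl⟩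
  | imp _ _ h₁ h₂ =>
    obtain ⟨R₁, h₁⟩ := h₁
    obtain ⟨R₂, h₂⟩ := h₂
    refine ⟨fun a b c d => R₁ a b c d → R₂ a b c d, fun S C hS x v => ?_⟩
    let := setVarStructure C
    rw [BoundedFormula.realize_imp]
    exact imp_congr (h₁ S C hS x v) (h₂ S C hS x v)
  | of_isAtomic h =>
    cases h with
    | equal t₁ t₂ =>
      obtain ⟨i, rfl⟩ := exists_eq_var t₁
      obtain ⟨j, rfl⟩ := exists_eq_var t₂
      refine ⟨fun _ _ _ d => i = j ∨ d, fun S C hS x v => ?_⟩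
      let := setVarStructure C
      simp only [BoundedFormula.realize_bdEqual, Term.realize_var, Sum.elim_inr]
      fin_cases i <;> fin_cases j <;> simp [eq_comm]
    | rel r ts =>
      choose i hi using fun j => exists_eq_var (ts j)
      obtain rfl : ts = fun j => Term.var (Sum.inr (i j)) := funext hi
      rcases r with r | r
      · cases r
        -- Being basic matters here: a loop atom is false, and the two orders of the variables give
        -- the same truth value.
        refine ⟨fun _ _ c _ => i 0 ≠ i 1 ∧ c, fun S C hS x v => ?_⟩
        obtain ⟨hirr, hsymm⟩ := Theory.simpleGraph_model_iff.1 hS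
        let := setVarStructure C
        have e (u : Fin 2 → S.carrier) : u = ![u 0, u 1] := by
          ext j; fin_cases j <;> rfl
        change Structure.RelMap adj (fun j => v (i j)) ↔ _
        rw [e fun j => v (i j)]
        have h1 := hsymm.symm (v 0) (v 1)
        have h2 := hsymm.symm (v 1) (v 0)
        have h3 := fun j => hirr.irrefl (v j)
        generalize i 0 = a
        generalize i 1 = b
        fin_cases a <;> fin_cases b <;> simp [h3]
        exact ⟨h2, h1⟩
      · cases r
        refine ⟨fun a b _ _ => if i 0 = 0 then a else b, fun S C hS x v => ?_⟩
        let := setVarStructure C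
        change v (i 0) ∈ C ↔ _
        generalize i 0 = a
        fin_cases a <;> simp

theorem exists_constraint {φ : SetSentence Language.graph}
    (hφ : HasPattern [FOQuantifier.a, FOQuantifier.a] φ) :
    ∃ R : Prop → Prop → Prop → Prop → Prop,
      ∀ (S : FinStruc Language.graph) (C : Finset S.carrier), IsBasic S →
        (Holds S φ C ↔ ∀ u v, R (u ∈ C) (v ∈ C) (Structure.RelMap adj ![u, v]) (u = v)) := by
  cases hφ with
  | all h =>
    cases h with
    | all h =>
      cases h with
      | qf h =>
        obtain ⟨R, hR⟩ := exists_truthTable h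
        refine ⟨R, fun S C hS => ?_⟩
        let := setVarStructure C
        refine forall₂_congr fun u v => ?_
        exact hR S C hS default (Fin.snoc (Fin.snoc default u) v)

/-! ### The circuits -/

/-- The digraph encoded by a word of length `n * n`. -/
def wordAdj {n : ℕ} (x : Fin (n * n) → Bool) (u v : Fin n) : Prop :=
  x (finProdFinEquiv (u, v)) = true

theorem ac_satisfies {n q t : ℕ} (hq : 2 ≤ q) (hn : n ≤ q)
    (R : Prop → Prop → Prop → Prop → Prop) {D : (Fin (n * n) → Bool) → Fin n → Prop}
    (hD : ∀ v, AC q t fun x => D x v) :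
    AC q (t + 19) fun x => Satisfies R (wordAdj x) (D x) := by
  have h : ∀ u v, AC q (t + 17) fun x => R (D x u) (D x v) (wordAdj x u v) (u = v) := by
    intro u v
    have h := (hD u).apply_imp hq (F := fun p x => R p (D x v) (wordAdj x u v) (u = v)) fun p₁ =>
      (hD v).apply_imp hq (F := fun p x => R p₁ p (wordAdj x u v) (u = v)) fun p₂ =>
      (AC.bit (finProdFinEquiv (u, v))).apply_imp hq (F := fun p _ => R p₁ p₂ p (u = v)) fun p₃ =>
        AC.const _ (by omega)
    exact h.mono (by omega)
  exact AC.all (fun u => AC.all (h u) (by simpa)) (by simpa)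

theorem ac_kernel {n q m : ℕ} (hq : 2 ≤ q) (hn : n ≤ q) (c : Fin n → Fin m) (v : Fin n) :
    AC q 30 fun x => Kernel (wordAdj x) c v := by
  have hb (u v : Fin n) : AC q 0 fun x => wordAdj x u v := AC.bit _
  have htwin (w : Fin n) : AC q 20 fun x => Twin (wordAdj x) v w := by
    refine (AC.all (t := 17) (fun z => ?_) (by simpa)).mono (by omega)
    have h := (((hb v z).imp (hb w z) hq).and ((hb w z).imp (hb v z) hq) hq).congr
      (Q := fun x => wordAdj x v z ↔ wordAdj x w z) fun x => iff_iff_implies_and_implies.symm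
    exact ((AC.const (z ≠ v) (by omega)).imp ((AC.const (z ≠ w) (by omega)).imp h hq) hq).mono
      (by omega)
  refine (AC.all (t := 29) (fun w => ?_) (by simpa))
  exact ((AC.const (w < v) (by omega)).imp ((AC.const (c w = c v) (by omega)).imp
    ((htwin w).not (by omega)) hq) hq).mono (by omega)

theorem ac_basic {n q : ℕ} (hq : 2 ≤ q) (hn : n ≤ q) :
    AC q 10 fun x : Fin (n * n) → Bool =>
      (∀ u v, wordAdj x u v → wordAdj x v u) ∧ ∀ u, ¬ wordAdj x u u := by
  have hb (u v : Fin n) : AC q 0 fun x => wordAdj x u v := AC.bit _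
  have h1 := AC.all (fun u => AC.all (fun v => (hb u v).imp (hb v u) hq) (by simpa)) (by simpa)
  have h2 := AC.all (fun u => (hb u u).not (by omega)) (by simpa)
  exact (h1.and h2 hq).mono (by omega)

/-- The number of colours for the second hash function. -/
def numColours (k : ℕ) : ℕ := 4 * (k + (4 * k ^ 2 + 1) * 2 ^ k) ^ 2 + 1

theorem computable_bound (t : ℕ) :
    Computable fun k => (2 ^ (numColours k + 1) + 1) ^ t := by
  have hpow {f g : ℕ → ℕ} (hf : Primrec f) (hg : Primrec g) : Primrec fun k => f k ^ g k :=
    (Primrec₂.unpaired'.1 Nat.Primrec.pow).comp hf hg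
  have hadd {f g : ℕ → ℕ} (hf : Primrec f) (hg : Primrec g) : Primrec fun k => f k + g k :=
    Primrec.nat_add.comp hf hg
  have hmul {f g : ℕ → ℕ} (hf : Primrec f) (hg : Primrec g) : Primrec fun k => f k * g k :=
    Primrec.nat_mul.comp hf hg
  have hc (c : ℕ) : Primrec fun _ : ℕ => c := Primrec.const c
  have hid : Primrec fun k : ℕ => k := Primrec.id
  exact (hpow (hadd (hpow (hc 2) (hadd (hadd (hmul (hc 4) (hpow (hadd hid (hmul (hadd (hmul (hc 4)
    (hpow hid (hc 2))) (hc 1)) (hpow (hc 2) hid))) (hc 2))) (hc 1)) (hc 1))) (hc 1)) (hc t)).to_comp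

theorem ac_exists_solution (R : Prop → Prop → Prop → Prop → Prop) (n k : ℕ) :
    AC (2 ^ (numColours k + 1) * (n + 1)) 100 fun x : Fin (n * n) → Bool =>
      ((∀ u v, wordAdj x u v → wordAdj x v u) ∧ ∀ u, ¬ wordAdj x u u) ∧
      ∃ C : Finset (Fin n), C.card ≤ k ∧ Satisfies R (wordAdj x) (· ∈ C) := by
  set g := 2 ^ (numColours k + 1) with hg
  set q := g * (n + 1) with hq_def
  obtain ⟨M₁, c₁, hM₁, h₁⟩ := exists_hash_family k n
  obtain ⟨M₂, c₂, hM₂, h₂⟩ := exists_hash_family (k + (4 * k ^ 2 + 1) * 2 ^ k) n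
  change Fin M₂ → Fin n → Fin (numColours k) at c₂
  have hm : numColours k + 1 ≤ 2 ^ numColours k := Nat.lt_two_pow_self
  have hg2 : g = 2 * 2 ^ numColours k := by rw [hg, pow_succ, mul_comm]
  have hnum : numColours k = 4 * (k + (4 * k ^ 2 + 1) * 2 ^ k) ^ 2 + 1 := rfl
  have hq : 2 ≤ q := by nlinarith
  have hn : n ≤ q := by nlinarith
  -- The factor `8 * s ^ 2 + 4` from the second family equals `2 * (numColours k + 1)`, hence is at
  -- most `g`.
  have hM₂q : M₂ ≤ q := hM₂.trans (Nat.mul_le_mul_right _ (by omega))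
  have hM₁q : M₁ ≤ q := by
    refine hM₁.trans (Nat.mul_le_mul_right _ ?_)
    have : k ^ 2 ≤ (k + (4 * k ^ 2 + 1) * 2 ^ k) ^ 2 := Nat.pow_le_pow_left (by omega) 2
    omega
  have hSq : Fintype.card {S : Finset (Fin (numColours k)) // S.card ≤ k} ≤ q := by
    refine (Fintype.card_subtype_le _).trans ?_
    rw [Fintype.card_finset, Fintype.card_fin]
    nlinarith
  have hD (a : Fin M₁) (b : Fin M₂) (S : {S : Finset (Fin (numColours k)) // S.card ≤ k})
      (v : Fin n) : AC q 31 fun x => c₂ b v ∈ S.1 ∧ Kernel (wordAdj x) (c₁ a) v :=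
    ((AC.const _ (by omega)).and (ac_kernel hq hn (c₁ a) v) hq).mono (by omega)
  have hmain := AC.ex (fun a => AC.ex (fun b => AC.ex (fun S =>
    (AC.all (fun u => AC.all (fun v => (hD a b S u).imp ((hD a b S v).imp
      (AC.const (c₂ b u = c₂ b v → u = v) (by omega)) hq) hq) (by simpa)) (by simpa)).and
    (ac_satisfies hq hn R (hD a b S)) hq) hSq (by omega)) (by simpa) (by omega)) (by simpa)
    (by omega)
  refine (((ac_basic hq hn).and hmain hq).congr fun x => and_congr_right fun hx => ?_).mono
    (by omega)
  exact (exists_satisfies_iff c₁ c₂ h₁ h₂ hx.1 hx.2).symm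

theorem wordAdj_adjMatrixWord {S : FinStruc Language.graph} {n : ℕ} (e : S.carrier ≃ Fin n)
    (u v : Fin n) :
    wordAdj (adjMatrixWord e) u v ↔ Structure.RelMap adj ![e.symm u, e.symm v] := by
  simp [wordAdj, adjMatrixWord]

theorem isBasic_iff {S : FinStruc Language.graph} {n : ℕ} (e : S.carrier ≃ Fin n) :
    IsBasic S ↔
      (∀ u v, wordAdj (adjMatrixWord e) u v → wordAdj (adjMatrixWord e) v u) ∧
        ∀ u, ¬ wordAdj (adjMatrixWord e) u u := by
  simp only [wordAdj_adjMatrixWord]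
  refine Theory.simpleGraph_model_iff.trans ⟨fun h => ?_, fun h => ⟨⟨fun u => ?_⟩, ⟨fun u v => ?_⟩⟩⟩
  · exact ⟨fun u v => h.2.symm _ _, fun u => h.1.irrefl _⟩
  · simpa using h.2 (e u)
  · simpa using h.1 (e u) (e v)

theorem mem_pModelsBasicLe_iff {φ : SetSentence Language.graph}
    {R : Prop → Prop → Prop → Prop → Prop}
    (hR : ∀ (S : FinStruc Language.graph) (C : Finset S.carrier), IsBasic S →
      (Holds S φ C ↔ ∀ u v, R (u ∈ C) (v ∈ C) (Structure.RelMap adj ![u, v]) (u = v)))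
    (S : FinStruc Language.graph) {n : ℕ} (k : ℕ) (e : S.carrier ≃ Fin n) :
    (S, k) ∈ pModelsBasicLe φ ↔
      ((∀ u v, wordAdj (adjMatrixWord e) u v → wordAdj (adjMatrixWord e) v u) ∧
        ∀ u, ¬ wordAdj (adjMatrixWord e) u u) ∧
      ∃ C : Finset (Fin n), C.card ≤ k ∧ Satisfies R (wordAdj (adjMatrixWord e)) (· ∈ C) := by
  rw [← isBasic_iff]
  refine and_congr_right fun hS => ?_
  have key (C : Finset S.carrier) : Holds S φ C ↔
      Satisfies R (wordAdj (adjMatrixWord e)) (· ∈ C.map e.toEmbedding) := by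
    rw [hR S C hS]
    simp only [Satisfies, wordAdj_adjMatrixWord, Finset.mem_map_equiv]
    refine ⟨fun h u v => by simpa using h (e.symm u) (e.symm v),
      fun h u v => by simpa using h (e u) (e v)⟩
  constructor
  · rintro ⟨C, hk, hC⟩
    exact ⟨C.map e.toEmbedding, by simpa using hk, (key C).1 hC⟩
  · rintro ⟨C, hk, hC⟩
    refine ⟨C.map e.symm.toEmbedding, by simpa using hk, (key _).2 ?_⟩
    simpa [Finset.map_map] using hC

theorem pModelsBasicLe_mem_paraAC0 {φ : SetSentence Language.graph}
    (hφ : HasPattern [FOQuantifier.a, FOQuantifier.a] φ) : pModelsBasicLe φ ∈ ParaAC0 := by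
  obtain ⟨R, hR⟩ := exists_constraint hφ
  obtain ⟨t, ht, hAC⟩ : ∃ t, 2 ≤ t ∧ ∀ n k, AC (2 ^ (numColours k + 1) * (n + 1)) t
      fun x : Fin (n * n) → Bool =>
        ((∀ u v, wordAdj x u v → wordAdj x v u) ∧ ∀ u, ¬ wordAdj x u u) ∧
        ∃ C : Finset (Fin n), C.card ≤ k ∧ Satisfies R (wordAdj x) (· ∈ C) :=
    ⟨100, by norm_num, ac_exists_solution R⟩
  have hcirc (N k : ℕ) : ∃ C : Circuit N, C.depth ≤ t ∧
      C.size ≤ (2 ^ (numColours k + 1) + 1) ^ t * (N + 1) ^ t ∧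
      ∀ (S : FinStruc Language.graph) (n : ℕ) (e : S.carrier ≃ Fin n) (h : n * n = N),
        (S, k) ∈ pModelsBasicLe φ ↔ C.Accepts (adjMatrixWord e ∘ Fin.cast h.symm) := by
    by_cases hN : ∃ n, n * n = N
    · obtain ⟨n, rfl⟩ := hN
      obtain ⟨C, hd, hs, hC⟩ := (hAC n k).exists_circuit
      refine ⟨C, hd, hs.trans ?_, fun S n' e h => ?_⟩
      · rw [← mul_pow]
        refine Nat.pow_le_pow_left ?_ _
        have : n ≤ n * n := Nat.le_mul_self n
        nlinarith [Nat.mul_le_mul_left (2 ^ (numColours k + 1)) this]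
      · obtain rfl : n' = n := Nat.mul_self_inj.1 h
        exact (mem_pModelsBasicLe_iff hR S k e).trans (hC _).symm
    -- No digraph has an encoding of non-square length, so any small circuit will do.
    · obtain ⟨C, hd, hs, -⟩ :=
        ((AC.const (N := N) (q := 1) True le_rfl).mono ht).exists_circuit
      refine ⟨C, hd, hs.trans ?_, fun S n e h => absurd ⟨n, h⟩ hN⟩
      rw [← mul_pow]
      refine Nat.pow_le_pow_left ?_ _
      have : 1 ≤ 2 ^ (numColours k + 1) := Nat.one_le_two_pow
      nlinarith
  choose C hd hs hC using hcirc
  exact ⟨C, t, t, fun k => (2 ^ (numColours k + 1) + 1) ^ t, computable_bound t,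
    fun N k => ⟨hd N k, hs N k⟩, fun S k n e => hC (n * n) k S n e rfl⟩

end WeightedESO

theorem mainTheorem4 :
    WeightedESO.PFDBasicLe [WeightedESO.FOQuantifier.a, WeightedESO.FOQuantifier.a] ⊆
      WeightedESO.ParaAC0 := by
  rintro Q ⟨φ, hφ, rfl⟩
  exact WeightedESO.pModelsBasicLe_mem_paraAC0 hφ
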